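/- **Setting.** Let $n\ge 2$ and $2\le q\le n$ be integers. The *$q$-transversal random matrix* with $m=qk$ rows is the random $m\times n$ binary matrix $M$ obtained from a $q$-ary $k\times n$ matrix $M'$, whose entries are independent and uniform in $[q]=\{1,\dots,q\}$, by replacing each row $r$ of $M'$ by the $q$ binary rows $(r,\sigma)$, $\sigma\in[q]$, where $M_{(r,\sigma),j}=1$ if and only if $M'_{r,j}=\sigma$. The uniform transversal design model UTDq consists of these random matrices for all $q$ with $2\le q\le n$. Let $d\ge1$ and let $I\subseteq[n]$ with $|I|\le d$ be the set of defective items. A binary matrix $M$ is *$(n,I)$-disjunct* if for every $i\in[n]\setminus I$ there is a row $t$ with $M_{t,i}=1$ and $M_{t,j}=0$ for all $j\in I$. It is *$(n,I)$-separable* if $\bigvee_{j\in J}M^{(j)}\ne\bigvee_{i\in I}M^{(i)}$ for every $J\subseteq[n]$ with $|J|\le d$ and $J\ne I$, where $M^{(j)}$ is the $j$th column of $M$ and $\bigvee$ is the bitwise "or"; that is, the answers to the tests determine $I$. Fix a constant $0<\delta<1$. Let $m^D_{\mathrm{UTDq}}(n,d)$ (respectively $m_{\mathrm{UTDq}}(n,d)$)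 be the minimum of $m=qk$ over all $2\le q\le n$ and $k\ge0$ such that, for every $I\subseteq[n]$ with $|I|\le d$, the $q$-transversal random matrix with $m$ rows is $(n,I)$-disjunct (respectively $(n,I)$-separable) with probability at least $1-\delta$. Put $$c^D_{\mathrm{UTDq}}(d)=\lim_{n\to\infty}\frac{m^D_{\mathrm{UTDq}}(n,d)}{\ln n},\qquad c^D_{\mathrm{UTDq}}=\lim_{d\to\infty}\frac{c^D_{\mathrm{UTDq}}(d)}{d},$$ $$\underline c_{\mathrm{UTDq}}(d)=\liminf_{n\to\infty}\frac{m_{\mathrm{UTDq}}(n,d)}{\ln n},\qquad \overline c_{\mathrm{UTDq}}(d)=\limsup_{n\to\infty}\frac{m_{\mathrm{UTDq}}(n,d)}{\ln n}.$$ Let $R_{q,d,i}$ be the number of strings in $[q]^d$ with exactly $i$ distinct symbols, and $$P_{q,d}=\Bigl(\prod_{i=1}^d\bigl(\tfrac iq\bigr)^{R_{q,d,i}}\Bigr)^{1/q^d}.$$ **Theorem.** For every constant $0<\delta<1$ and every $d\ge1$ the limit $c^D_{\mathrm{UTDq}}(d)$ exists, the minimum below over all integers $q\ge2$ is attained, and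 $$c^D_{\mathrm{UTDq}}(d)=\min_{q\ge2}\frac{q}{-\ln P_{q,d}}.$$ Moreover $c^D_{\mathrm{UTDq}}=\dfrac1{(\ln2)^2}$, and $$c_{\mathrm{UTDq}}=\lim_{d\to\infty}\frac{\underline c_{\mathrm{UTDq}}(d)}{d}=\lim_{d\to\infty}\frac{\overline c_{\mathrm{UTDq}}(d)}{d}=\frac1{(\ln 2)^2}.$$ -/

import Mathlib

open Filter Topology

namespace GroupTesting

/-- The vector of answers `T(I, M)`: the bit-wise "or" of the columns of `M` indexed by `I`. -/
def answers {ρ : Type*} {n : ℕ} (M : Matrix ρ (Fin n) Bool) (I : Finset (Fin n)) : ρ → Bool :=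
  fun t => decide (∃ i ∈ I, M t i = true)

/-- `M` is `(n, I)`-separable with respect to at most `d` defectives: `I` is the only set of at
most `d` items that is consistent with the answers of the tests. -/
def IsSeparable {ρ : Type*} {n : ℕ} (d : ℕ) (M : Matrix ρ (Fin n) Bool)
    (I : Finset (Fin n)) : Prop :=
  ∀ J : Finset (Fin n), J.card ≤ d → J ≠ I → answers M J ≠ answers M I

/-- `M` is `(n, I)`-disjunct: every item outside `I` is contained in a test (row) that contains no
item of `I`. -/
def IsDisjunct {ρ : Type*} {n : ℕ} (M : Matrix ρ (Fin n) Bool) (I : Finset (Fin n)) : Prop :=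
  ∀ i, i ∉ I → ∃ t, M t i = true ∧ ∀ j ∈ I, M t j = false

/-- The binary matrix obtained from a `q`-ary matrix with `k` rows: each row `r` is expanded to `q`
binary rows `(r, σ)`, the row `(r, σ)` having a `1` exactly where the row `r` has the symbol `σ`.
It has `q * k` rows. -/
def toBinary {k n q : ℕ} (M' : Matrix (Fin k) (Fin n) (Fin q)) :
    Matrix (Fin k × Fin q) (Fin n) Bool :=
  fun t j => decide (M' t.1 j = t.2)

/-- The probability that the transversal matrix derived from a uniform random `q`-ary `k × n`
matrix has the property `E`. Independent uniform entries mean that all `q`-ary `k × n` matrices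
are equally likely. -/
noncomputable def utdProb (k n q : ℕ) (E : Matrix (Fin k × Fin q) (Fin n) Bool → Prop) : ℝ :=
  (Nat.card {M' : Matrix (Fin k) (Fin n) (Fin q) // E (toBinary M')} : ℝ) /
    (Nat.card (Matrix (Fin k) (Fin n) (Fin q)) : ℝ)

/-- The minimum number of tests `m = q * k` of a uniform random transversal design, over all
alphabet sizes `2 ≤ q ≤ n`, such that for every set `I` of at most `d` items the test matrix is
`(n, I)`-disjunct with probability at least `1 - δ`. -/
noncomputable def mDisjunct (δ : ℝ) (n d : ℕ) : ℕ :=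
  sInf {m : ℕ | ∃ q k : ℕ, 2 ≤ q ∧ q ≤ n ∧ m = q * k ∧
    ∀ I : Finset (Fin n), I.card ≤ d → 1 - δ ≤ utdProb k n q (fun M => IsDisjunct M I)}

/-- The same with separability: the minimum number of tests that ensures, for every set `I` of at
most `d` items, that with probability at least `1 - δ` the answers determine `I`. -/
noncomputable def mSeparable (δ : ℝ) (n d : ℕ) : ℕ :=
  sInf {m : ℕ | ∃ q k : ℕ, 2 ≤ q ∧ q ≤ n ∧ m = q * k ∧
    ∀ I : Finset (Fin n), I.card ≤ d → 1 - δ ≤ utdProb k n q (fun M => IsSeparable d M I)}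

/-- The lower limit, as `n → ∞`, of the number of tests divided by `ln n`. -/
noncomputable def cLower (δ : ℝ) (d : ℕ) : EReal :=
  liminf (fun n : ℕ => (((mSeparable δ n d : ℝ) / Real.log n : ℝ) : EReal)) atTop

/-- The upper limit, as `n → ∞`, of the number of tests divided by `ln n`. -/
noncomputable def cUpper (δ : ℝ) (d : ℕ) : EReal :=
  limsup (fun n : ℕ => (((mSeparable δ n d : ℝ) / Real.log n : ℝ) : EReal)) atTop

/-- `R_{q,d,i}`: the number of strings in `[q]^d` with exactly `i` distinct symbols. -/
def R (q d i : ℕ) : ℕ :=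
  (Finset.univ.filter (fun v : Fin d → Fin q => (Finset.univ.image v).card = i)).card

/-- `P_{q,d} = (∏_{i=1}^d (i/q)^{R_{q,d,i}})^{1/q^d}`. -/
noncomputable def P (q d : ℕ) : ℝ :=
  (∏ i ∈ Finset.Icc 1 d, ((i : ℝ) / (q : ℝ)) ^ R q d i) ^ (1 / (q : ℝ) ^ d)

end GroupTesting

/-!
Write `D(v)` for the number of distinct symbols of a string `v ∈ [q]^d`, and
`rate q d = -log P q d` for the average of `-log (D / q)`.

**Threshold for fixed `d`.** If `|I| = d` and the rows of the `q`-ary matrix restricted to `I` are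
`A 1, …, A k`, an item outside `I` fails to be eliminated with probability `y = ∏ r, D (A r) / q`,
independently of the other items, so that the design is disjunct with probability
`E (1 - y) ^ (n - d)` (`utdProb_isDisjunct_eq`). Since `y` is about `exp (-k * rate q d)`, the
transition takes place at `k ≈ log n / rate q d`. The concentration of `y` is replaced by moments of
small order `±t`: the failure probability is at most `E (n y) ^ t`, the success probability at most
`E ((n - d) y) ^ (-t)`, these moments are `k`-th powers because the rows are independent, and the
derivative of `E (D / q) ^ t` at `t = 0` is `-rate q d`. Large alphabets, whose size may grow
with `n`, are excluded by `q / rate q d ≥ q / log q`, in the quantitative form given by the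
moment of order `-1`.

**Separability.** A matrix that is disjunct for `I` and for all `I \ {j}` is separable for `I`, and
a matrix that is separable for `I` is disjunct for `I` if `|I| < d`. So the separability threshold
for `d` lies between the disjunctness thresholds for `d - 1` and `d`.

**Growth in `d`.** Jensen's inequality bounds `rate q d` from below by
`-log (1 - (1 - 1 / q) ^ d)`, and `q ≈ d / log 2` gives `log 2`. For the upper bound, `log (q / D)`
is compared with the difference of harmonic numbers `∑ j, C(q - D, j) / (j C(q, j))`, whose average
is exactly `∑ j, (1 - j / q) ^ d / j ≤ -log (1 - exp (-d / q))` (`rate_le_sum`). With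
`u = exp (-d / q)` this yields
`d * rate q d / q ≤ log u * log (1 - u) + 4 / d ≤ (log 2) ^ 2 + 4 / d` (`rate_mul_le`), uniformly
in `q`.
-/

namespace GroupTesting

/-! ### The rate of an alphabet size -/

/-- The number of distinct symbols of a string. -/
def distinct {q d : ℕ} (v : Fin d → Fin q) : ℕ := (Finset.univ.image v).card

/-- The average of `-log (D / q)` over all strings in `[q]^d`, `D` being the number of distinct
symbols. -/
noncomputable def rate (q d : ℕ) : ℝ :=
  (∑ v : Fin d → Fin q, -Real.log ((distinct v : ℝ) / q)) / (q : ℝ) ^ d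

lemma distinct_le_length {q d : ℕ} (v : Fin d → Fin q) : distinct v ≤ d := by
  simpa [distinct] using (Finset.card_image_le (s := Finset.univ) (f := v))

lemma distinct_le_alphabet {q d : ℕ} (v : Fin d → Fin q) : distinct v ≤ q := by
  simpa [distinct] using (Finset.card_le_univ (Finset.univ.image v))

lemma one_le_distinct {q d : ℕ} (hd : 1 ≤ d) (v : Fin d → Fin q) : 1 ≤ distinct v := by
  have : (Finset.univ.image v).Nonempty := ⟨v ⟨0, hd⟩, by simp⟩
  exact this.card_pos

theorem rate_eq_neg_log_P {q d : ℕ} (hq : 2 ≤ q) (hd : 1 ≤ d) :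
    rate q d = -Real.log (P q d) := by
  have hq0 : (0 : ℝ) < q := by positivity
  have hpos : ∀ i ∈ Finset.Icc 1 d, (0 : ℝ) < ((i : ℝ) / (q : ℝ)) ^ R q d i := by
    intro i hi
    have : (0 : ℝ) < i := by exact_mod_cast (Finset.mem_Icc.1 hi).1
    positivity
  unfold rate P
  rw [Real.log_rpow (Finset.prod_pos hpos), Real.log_prod fun i hi => (hpos i hi).ne',
    Finset.sum_neg_distrib]
  have : ∑ v : Fin d → Fin q, Real.log ((distinct v : ℝ) / q) =
      ∑ i ∈ Finset.Icc 1 d, Real.log (((i : ℝ) / (q : ℝ)) ^ R q d i) := by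
    rw [← Finset.sum_fiberwise_of_maps_to (t := Finset.Icc 1 d) (g := fun v => distinct v)
      fun v _ => Finset.mem_Icc.2 ⟨one_le_distinct hd v, distinct_le_length v⟩]
    refine Finset.sum_congr rfl fun i _ => ?_
    rw [Real.log_pow, Finset.sum_congr rfl fun v hv => by rw [(Finset.mem_filter.1 hv).2],
      Finset.sum_const, nsmul_eq_mul]
    rfl
  rw [this]
  ring

lemma neg_log_distinct_nonneg {q d : ℕ} (v : Fin d → Fin q) :
    0 ≤ -Real.log ((distinct v : ℝ) / q) := by
  have h : (distinct v : ℝ) / q ≤ 1 :=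
    div_le_one_of_le₀ (by exact_mod_cast distinct_le_alphabet v) (by positivity)
  linarith [Real.log_nonpos (by positivity) h]

theorem rate_pos {q d : ℕ} (hq : 2 ≤ q) (hd : 1 ≤ d) : 0 < rate q d := by
  refine div_pos ?_ (by positivity)
  refine Finset.sum_pos' (fun v _ => neg_log_distinct_nonneg v)
    ⟨fun _ => ⟨0, by omega⟩, Finset.mem_univ _, ?_⟩
  have h1 : distinct (fun _ : Fin d => (⟨0, by omega⟩ : Fin q)) = 1 := by
    have : Nonempty (Fin d) := ⟨⟨0, hd⟩⟩
    simp [distinct, Finset.image_const Finset.univ_nonempty]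
  have h2 : (1 : ℝ) < q := by exact_mod_cast hq
  rw [h1, Nat.cast_one, one_div, Real.log_inv, neg_neg]
  exact Real.log_pos h2

theorem rate_le_log {q d : ℕ} (hq : 2 ≤ q) (hd : 1 ≤ d) : rate q d ≤ Real.log q := by
  have hq0 : (0 : ℝ) < q := by positivity
  rw [rate, div_le_iff₀ (by positivity)]
  refine (Finset.sum_le_card_nsmul _ _ (Real.log q) fun v _ => ?_).trans (le_of_eq ?_)
  · have h1 : (1 : ℝ) ≤ distinct v := by exact_mod_cast one_le_distinct hd v
    rw [Real.log_div (by positivity) hq0.ne']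
    linarith [Real.log_nonneg h1]
  · simp [mul_comm]

/-! ### Upper bound for the rate -/

/-- Double counting of the pairs `(v, S)` where `S` is a set of `j` symbols that do not occur
in `v`. -/
theorem sum_choose_missing (q d j : ℕ) :
    ∑ v : Fin d → Fin q, (q - distinct v).choose j = q.choose j * (q - j) ^ d := by
  have h1 : ∀ v : Fin d → Fin q, (q - distinct v).choose j =
      ∑ S ∈ Finset.powersetCard j (Finset.univ : Finset (Fin q)),
        if ∀ i, v i ∉ S then 1 else 0 := by
    intro v
    have h : q - distinct v = ((Finset.univ.image v)ᶜ).card := by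
      simp [Finset.card_compl, distinct]
    rw [h, ← Finset.card_powersetCard, ← Finset.card_filter]
    congr 1
    ext S
    simp only [Finset.mem_powersetCard, Finset.mem_filter, Finset.subset_univ, true_and]
    constructor
    · rintro ⟨h, hc⟩
      exact ⟨hc, fun i hi => by simpa using h hi⟩
    · rintro ⟨hc, h⟩
      refine ⟨fun x hx => ?_, hc⟩
      simp only [Finset.mem_compl, Finset.mem_image, Finset.mem_univ, true_and, not_exists]
      rintro i rfl
      exact h i hx
  simp_rw [h1]
  rw [Finset.sum_comm]
  have h2 : ∀ S ∈ Finset.powersetCard j (Finset.univ : Finset (Fin q)),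
      (∑ v : Fin d → Fin q, if ∀ i, v i ∉ S then 1 else 0) = (q - j) ^ d := by
    intro S hS
    have : (Finset.univ.filter fun v : Fin d → Fin q => ∀ i, v i ∉ S) =
        Fintype.piFinset fun _ => Sᶜ := by
      ext v; simp
    rw [← Finset.card_filter, this, Fintype.card_piFinset]
    simp [Finset.card_compl, (Finset.mem_powersetCard.1 hS).2]
  rw [Finset.sum_congr rfl h2]
  simp

/-- `∑ i, C(E, i) / C(m, i) = (m + 1) / (m + 1 - E)`. -/
lemma sum_choose_div_choose (E : ℕ) : ∀ m : ℕ, E ≤ m →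
    ∑ i ∈ Finset.range (m + 1), (E.choose i : ℝ) / m.choose i = (m + 1) / (m + 1 - E) := by
  induction E with
  | zero =>
    intro m _
    rw [Finset.sum_range_succ']
    have : (m : ℝ) + 1 ≠ 0 := by positivity
    simp [this]
  | succ E ih =>
    intro m hm
    obtain ⟨m, rfl⟩ : ∃ m', m = m' + 1 := ⟨m - 1, by omega⟩
    have hE : (E : ℝ) ≤ m := by exact_mod_cast (by omega : E ≤ m)
    rw [Finset.sum_range_succ']
    have h : ∀ i ∈ Finset.range (m + 1), ((E + 1).choose (i + 1) : ℝ) / (m + 1).choose (i + 1) =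
        (E + 1) / (m + 1) * ((E.choose i : ℝ) / m.choose i) := by
      intro i hi
      have h1 : ((E : ℝ) + 1) * E.choose i = (E + 1).choose (i + 1) * (i + 1) := by
        exact_mod_cast Nat.add_one_mul_choose_eq E i
      have h2 : ((m : ℝ) + 1) * m.choose i = (m + 1).choose (i + 1) * (i + 1) := by
        exact_mod_cast Nat.add_one_mul_choose_eq m i
      have h3 : (m.choose i : ℝ) ≠ 0 := by
        exact_mod_cast (Nat.choose_pos (by simp at hi; omega)).ne'
      have h4 : ((m + 1).choose (i + 1) : ℝ) ≠ 0 := by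
        exact_mod_cast (Nat.choose_pos (by simp at hi; omega)).ne'
      have h5 : (i : ℝ) + 1 ≠ 0 := by positivity
      have h6 : (m : ℝ) + 1 ≠ 0 := by positivity
      rw [div_mul_div_comm, h1, h2, mul_div_mul_right _ _ h5]
    rw [Finset.sum_congr rfl h, ← Finset.mul_sum, ih m (by omega)]
    have h7 : (m : ℝ) + 1 - E ≠ 0 := by linarith
    have h8 : (m : ℝ) + 1 ≠ 0 := by positivity
    push_cast
    have h9 : (m : ℝ) + 1 + 1 - (E + 1) ≠ 0 := by
      intro h; apply h7; linarith
    simp only [Nat.choose_zero_right, Nat.cast_one]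
    field_simp
    ring

/-- `∑ j ≥ 1, C(E, j) / (j C(q, j))` grows by `1 / (q - E)` when `E` grows by one: it is the
difference of harmonic numbers `H q - H (q - E)`. -/
lemma sum_choose_div_mul_choose_succ {q E : ℕ} (hE : E < q) :
    ∑ j ∈ Finset.range q, ((E + 1).choose (j + 1) : ℝ) / ((j + 1) * q.choose (j + 1)) =
      ∑ j ∈ Finset.range q, (E.choose (j + 1) : ℝ) / ((j + 1) * q.choose (j + 1)) +
        1 / (q - E) := by
  obtain ⟨m, rfl⟩ : ∃ m', q = m' + 1 := ⟨q - 1, by omega⟩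
  have hS := sum_choose_div_choose E m (by omega)
  have h : ∀ j ∈ Finset.range (m + 1),
      ((E + 1).choose (j + 1) : ℝ) / ((j + 1) * (m + 1).choose (j + 1)) =
        (E.choose (j + 1) : ℝ) / ((j + 1) * (m + 1).choose (j + 1)) +
          1 / (m + 1) * ((E.choose j : ℝ) / m.choose j) := by
    intro j _
    have h2 : ((m : ℝ) + 1) * m.choose j = (m + 1).choose (j + 1) * (j + 1) := by
      exact_mod_cast Nat.add_one_mul_choose_eq m j
    rw [Nat.choose_succ_succ, div_mul_div_comm, h2]
    push_cast
    ring
  have h7 : (m : ℝ) + 1 - E ≠ 0 := by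
    have : (E : ℝ) < m + 1 := by exact_mod_cast hE
    linarith
  have h8 : (m : ℝ) + 1 ≠ 0 := by positivity
  rw [Finset.sum_congr rfl h, Finset.sum_add_distrib, ← Finset.mul_sum, hS]
  push_cast
  field_simp

/-- The comparison `log (q / (q - E)) ≤ H (q - 1) - H (q - E - 1)` of a logarithm with a difference
of harmonic numbers. -/
lemma log_div_le_sum_choose {q E : ℕ} (hE : E < q) :
    Real.log (q / (q - E)) ≤
      ∑ j ∈ Finset.range q, (E.choose (j + 1) : ℝ) / ((j + 1) * q.choose (j + 1)) +
        (1 / (q - E) - 1 / q) := by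
  induction E with
  | zero =>
    have : (q : ℝ) ≠ 0 := by exact_mod_cast hE.ne'
    simp [this]
  | succ E ih =>
    have hq : (E : ℝ) + 1 < q := by exact_mod_cast hE
    have hq0 : (0 : ℝ) < q := by linarith [(Nat.cast_nonneg E : (0 : ℝ) ≤ E)]
    have h1 : (0 : ℝ) < q - E := by linarith
    have h2 : (0 : ℝ) < q - (E + 1) := by linarith
    have ih := ih (by omega)
    rw [sum_choose_div_mul_choose_succ (by omega : E < q)]
    push_cast
    have h3 : Real.log (q / (q - (E + 1))) =
        Real.log (q / (q - E)) + Real.log ((q - E) / (q - (E + 1))) := by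
      rw [← Real.log_mul (by positivity) (by positivity)]
      congr 1
      field_simp
    have h4 := Real.log_le_sub_one_of_pos (div_pos h1 h2)
    have h5 : ((q : ℝ) - E) / (q - (E + 1)) - 1 = 1 / (q - (E + 1)) := by
      field_simp
      ring
    linarith

/-- A pointwise bound for `log (q / D)` by quantities whose average over all strings is explicit. -/
lemma neg_log_distinct_le {q d : ℕ} (hd : 1 ≤ d) (v : Fin d → Fin q) :
    -Real.log ((distinct v : ℝ) / q) ≤ ∑ j ∈ Finset.range q,
      (1 / ((j : ℝ) + 1) + 2 / q) * ((q - distinct v).choose (j + 1) / q.choose (j + 1)) := by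
  have hD1 := one_le_distinct hd v
  have hDq := distinct_le_alphabet v
  generalize distinct v = D at *
  obtain ⟨E, rfl⟩ : ∃ E, q = D + E := ⟨q - D, by omega⟩
  have hE : E < D + E := by omega
  have h1 := log_div_le_sum_choose hE
  have h2 := sum_choose_div_choose E (D + E) (by omega)
  rw [Finset.sum_range_succ'] at h2
  have hD : (1 : ℝ) ≤ D := by exact_mod_cast hD1
  have hE0 : (0 : ℝ) ≤ E := Nat.cast_nonneg E
  rw [← Real.log_inv, inv_div, Nat.add_sub_cancel_left]
  push_cast at h1 h2 ⊢
  simp only [add_sub_cancel_right] at h1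
  refine h1.trans ?_
  simp only [add_mul _ (2 / _ : ℝ), Finset.sum_add_distrib, ← Finset.mul_sum]
  refine add_le_add (le_of_eq (Finset.sum_congr rfl fun j _ => ?_)) ?_
  · rw [div_mul_div_comm, one_mul]
  · simp only [Nat.choose_zero_right, Nat.cast_one, div_one] at h2
    rw [eq_sub_of_add_eq h2]
    have h3 : ((D : ℝ) + E + 1) / (D + E + 1 - E) - 1 = E / (D + 1) := by
      have : (D : ℝ) + E + 1 - E = D + 1 := by ring
      rw [this]
      field_simp
      ring
    have h4 : 1 / (D : ℝ) - 1 / (D + E) = E / (D + E) * (1 / D) := by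
      field_simp
      ring
    have h5 : 2 / ((D : ℝ) + E) * (E / (D + 1)) = E / (D + E) * (2 / (D + 1)) := by
      field_simp
    rw [h3, h4, h5]
    refine mul_le_mul_of_nonneg_left ?_ (by positivity)
    rw [div_le_div_iff₀ (by positivity) (by positivity)]
    linarith

theorem rate_le_sum {q d : ℕ} (hq : 2 ≤ q) (hd : 1 ≤ d) :
    rate q d ≤ ∑ j ∈ Finset.range q,
      (1 / ((j : ℝ) + 1) + 2 / q) * Real.exp (-(d / q : ℝ)) ^ (j + 1) := by
  have hq0 : (0 : ℝ) < q := by positivity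
  rw [rate, div_le_iff₀ (by positivity)]
  refine (Finset.sum_le_sum fun v _ => neg_log_distinct_le hd v).trans ?_
  rw [Finset.sum_comm, Finset.sum_mul]
  refine Finset.sum_le_sum fun j hj => ?_
  have hj : j + 1 ≤ q := by simpa using hj
  rw [← Finset.mul_sum, ← Finset.sum_div, mul_assoc]
  refine mul_le_mul_of_nonneg_left ?_ (by positivity)
  have hc : (0 : ℝ) < q.choose (j + 1) := by exact_mod_cast Nat.choose_pos hj
  have h := sum_choose_missing q d (j + 1)
  have h' : (∑ v : Fin d → Fin q, ((q - distinct v).choose (j + 1) : ℝ)) =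
      q.choose (j + 1) * ((q : ℝ) - (j + 1 : ℕ)) ^ d := by
    rw [← Nat.cast_sub hj]
    exact_mod_cast h
  rw [h', mul_div_cancel_left₀ _ hc.ne']
  have h6 : (q : ℝ) - (j + 1 : ℕ) ≤ Real.exp (-((j + 1 : ℕ) / q : ℝ)) * q := by
    have := Real.add_one_le_exp (-((j + 1 : ℕ) / q : ℝ))
    calc (q : ℝ) - (j + 1 : ℕ) = (-((j + 1 : ℕ) / q : ℝ) + 1) * q := by field_simp; ring
      _ ≤ _ := mul_le_mul_of_nonneg_right this hq0.le
  have h7 : (0 : ℝ) ≤ (q : ℝ) - (j + 1 : ℕ) := by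
    rw [sub_nonneg]; exact_mod_cast hj
  refine (pow_le_pow_left₀ h7 h6 d).trans (le_of_eq ?_)
  rw [mul_pow, ← Real.exp_nat_mul, ← Real.exp_nat_mul]
  congr 2
  push_cast
  ring

/-- `log u * log (1 - u)` is maximal at `u = 1 / 2`. -/
theorem log_mul_log_one_sub_le {u : ℝ} (h0 : 0 < u) (h1 : u < 1) :
    Real.log u * Real.log (1 - u) ≤ Real.log 2 ^ 2 := by
  -- By symmetry `u ≤ 1 / 2`, where the function is increasing.
  wlog hu : u ≤ 1 / 2 generalizing u
  · have := this (u := 1 - u) (by linarith) (by linarith) (by linarith)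
    rwa [sub_sub_cancel, mul_comm] at this
  have hmono : MonotoneOn (fun u : ℝ => Real.log u * Real.log (1 - u)) (Set.Ioc 0 (1 / 2)) := by
    have hd : ∀ x ∈ Set.Ioc (0 : ℝ) (1 / 2), HasDerivAt
        (fun u : ℝ => Real.log u * Real.log (1 - u))
        (x⁻¹ * Real.log (1 - x) + Real.log x * (-1 / (1 - x))) x := by
      intro x hx
      have h2 : HasDerivAt (fun u : ℝ => 1 - u) (-1) x := (hasDerivAt_id x).const_sub 1
      exact (Real.hasDerivAt_log hx.1.ne').mul (h2.log (by linarith [hx.2]))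
    refine monotoneOn_of_deriv_nonneg (convex_Ioc _ _)
      (fun x hx => (hd x hx).continuousAt.continuousWithinAt)
      (fun x hx => (hd x (interior_subset hx)).differentiableAt.differentiableWithinAt) ?_
    intro x hx
    have hx := interior_subset hx
    rw [(hd x hx).deriv]
    have hx0 := hx.1
    have hx1 : 0 < 1 - x := by linarith [hx.2]
    -- The slope of `log` from `1` is decreasing; compare it at `x ≤ 1 - x`.
    have hs : x * Real.log x ≤ (1 - x) * Real.log (1 - x) := by
      rcases eq_or_lt_of_le (by linarith [hx.2] : x ≤ 1 - x) with h | h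
      · rw [← h]
      · have := strictConcaveOn_log_Ioi.concaveOn.slope_anti_adjacent (x := x) (y := 1 - x) (z := 1)
          hx0 (Set.mem_Ioi.2 one_pos) h (by linarith)
        rw [Real.log_one, div_le_div_iff₀ (by linarith) (by linarith)] at this
        nlinarith
    have : x⁻¹ * Real.log (1 - x) + Real.log x * (-1 / (1 - x)) =
        ((1 - x) * Real.log (1 - x) - x * Real.log x) / (x * (1 - x)) := by
      field_simp
      ring
    rw [this]
    exact div_nonneg (by linarith) (by positivity)
  have := hmono (Set.mem_Ioc.2 ⟨h0, hu⟩) (Set.mem_Ioc.2 ⟨by norm_num, le_rfl⟩) hu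
  refine this.trans (le_of_eq ?_)
  have h : (1 : ℝ) - 1 / 2 = 2⁻¹ := by norm_num
  simp only [h]
  rw [one_div, Real.log_inv]
  ring

/-- The rate is at most `(log 2) ^ 2 + 4 / d` times `q / d`, for every alphabet size. -/
theorem rate_mul_le {q d : ℕ} (hq : 2 ≤ q) (hd : 1 ≤ d) :
    d * rate q d ≤ (Real.log 2 ^ 2 + 4 / d) * q := by
  have hq0 : (0 : ℝ) < q := by positivity
  have hd0 : (0 : ℝ) < d := by exact_mod_cast hd
  obtain ⟨y, hy⟩ : ∃ y : ℝ, y = d / q := ⟨_, rfl⟩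
  have hy0 : 0 < y := by rw [hy]; positivity
  have hdy : (d : ℝ) = y * q := by rw [hy]; field_simp
  have h := rate_le_sum hq hd
  rw [← hy] at h
  obtain ⟨u, hu⟩ : ∃ u : ℝ, u = Real.exp (-y) := ⟨_, rfl⟩
  have hu0 : 0 < u := by rw [hu]; positivity
  have hu1 : u < 1 := by rw [hu, Real.exp_lt_one_iff]; linarith
  rw [← hu] at h
  simp only [add_mul, Finset.sum_add_distrib, ← Finset.mul_sum] at h
  have hs1 : ∑ j ∈ Finset.range q, 1 / ((j : ℝ) + 1) * u ^ (j + 1) ≤ -Real.log (1 - u) := by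
    have := Real.hasSum_pow_div_log_of_abs_lt_one (x := u) (by rwa [abs_of_pos hu0])
    have := sum_le_hasSum (Finset.range q) (fun i _ => by positivity) this
    refine (le_of_eq (Finset.sum_congr rfl fun j _ => ?_)).trans this
    ring
  have hs2 : ∑ j ∈ Finset.range q, u ^ (j + 1) ≤ u / (1 - u) := by
    have := (hasSum_geometric_of_lt_one hu0.le hu1).mul_left u
    have := sum_le_hasSum (Finset.range q) (fun i _ => by positivity) this
    refine (le_of_eq (Finset.sum_congr rfl fun j _ => ?_)).trans (this.trans (le_of_eq ?_))
    · ring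
    · rw [div_eq_mul_inv]
  have hmax : y * -Real.log (1 - u) ≤ Real.log 2 ^ 2 := by
    have := log_mul_log_one_sub_le hu0 hu1
    have hl : Real.log u = -y := by rw [hu, Real.log_exp]
    rw [hl] at this
    linarith
  have hc : y * (u / (1 - u)) ≤ 2 / y := by
    have h1 := Real.quadratic_le_exp_of_nonneg hy0.le
    have h2 : u * Real.exp y = 1 := by rw [hu, ← Real.exp_add]; simp
    rw [← mul_div_assoc, div_le_div_iff₀ (by linarith) hy0]
    nlinarith [mul_le_mul_of_nonneg_left h1 hu0.le, mul_pos hu0 hy0]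
  calc d * rate q d = q * (y * rate q d) := by rw [hdy]; ring
    _ ≤ q * (y * (-Real.log (1 - u) + 2 / q * (u / (1 - u)))) := by
      refine mul_le_mul_of_nonneg_left (mul_le_mul_of_nonneg_left (h.trans ?_) hy0.le) hq0.le
      exact add_le_add hs1 (mul_le_mul_of_nonneg_left hs2 (by positivity))
    _ = q * (y * -Real.log (1 - u) + 2 / q * (y * (u / (1 - u)))) := by ring
    _ ≤ q * (Real.log 2 ^ 2 + 2 / q * (2 / y)) := by gcongr
    _ = _ := by rw [hdy]; field_simp; ring

/-! ### Lower bound for the rate -/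

/-- Jensen's inequality for the logarithm, with `E D = q (1 - (1 - 1 / q) ^ d)`. -/
theorem neg_log_le_rate {q d : ℕ} (hq : 2 ≤ q) (hd : 1 ≤ d) :
    -Real.log (1 - (1 - 1 / (q : ℝ)) ^ d) ≤ rate q d := by
  have hq0 : (0 : ℝ) < q := by positivity
  have hsum : ∑ v : Fin d → Fin q, ((q : ℝ) - distinct v) = q * (q - 1) ^ d := by
    have h := sum_choose_missing q d 1
    simp only [Nat.choose_one_right] at h
    have h' := congrArg (fun n : ℕ => (n : ℝ)) h
    push_cast [Nat.cast_sub (by omega : 1 ≤ q)] at h'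
    rw [← h']
    exact Finset.sum_congr rfl fun v _ => (Nat.cast_sub (distinct_le_alphabet v)).symm
  have hJ := strictConcaveOn_log_Ioi.concaveOn.le_map_sum (t := Finset.univ)
    (w := fun _ : Fin d → Fin q => 1 / (q : ℝ) ^ d)
    (p := fun v => (distinct v : ℝ) / q) (fun _ _ => by positivity)
    (by simp [hq0.ne']) (fun v _ => by
      have : (0 : ℝ) < distinct v := by exact_mod_cast one_le_distinct hd v
      exact div_pos this hq0)
  simp only [smul_eq_mul, ← Finset.mul_sum] at hJ
  have hmean : 1 / (q : ℝ) ^ d * ∑ v : Fin d → Fin q, (distinct v : ℝ) / q =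
      1 - (1 - 1 / (q : ℝ)) ^ d := by
    rw [Finset.sum_sub_distrib] at hsum
    simp only [Finset.sum_const, Finset.card_univ, Fintype.card_pi, Fintype.card_fin,
      Finset.prod_const, nsmul_eq_mul] at hsum
    push_cast at hsum
    have h1 : (1 - 1 / (q : ℝ)) ^ d = (q - 1) ^ d / q ^ d := by
      rw [← div_pow]; congr 1; field_simp
    have h2 : ∑ v : Fin d → Fin q, (distinct v : ℝ) = q ^ d * q - q * (q - 1) ^ d := by
      linarith
    rw [← Finset.sum_div, h1, h2]
    field_simp
  rw [hmean] at hJ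
  rw [rate, Finset.sum_neg_distrib]
  have : 1 / (q : ℝ) ^ d * ∑ v : Fin d → Fin q, Real.log ((distinct v : ℝ) / q) =
    -((-∑ v : Fin d → Fin q, Real.log ((distinct v : ℝ) / q)) / (q : ℝ) ^ d) := by ring
  linarith

/-- With about `d / log 2` symbols, a symbol is absent with probability about `1 / 2`. -/
theorem log_two_le_rate {d : ℕ} (hd : 1 ≤ d) :
    Real.log 2 ≤ rate (⌈(d : ℝ) / Real.log 2⌉₊ + 1) d := by
  have hd0 : (0 : ℝ) < d := by exact_mod_cast hd
  have hl : 0 < Real.log 2 := Real.log_pos one_lt_two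
  have hpos : 0 < (d : ℝ) / Real.log 2 := by positivity
  have hceil : (d : ℝ) / Real.log 2 ≤ ⌈(d : ℝ) / Real.log 2⌉₊ := Nat.le_ceil _
  have hm1 : 1 ≤ ⌈(d : ℝ) / Real.log 2⌉₊ := Nat.ceil_pos.2 hpos
  generalize ⌈(d : ℝ) / Real.log 2⌉₊ = m at *
  have hm0 : (0 : ℝ) < m := by exact_mod_cast hm1
  refine le_trans ?_ (neg_log_le_rate (by omega) hd)
  have h1 : Real.exp (-(1 / m : ℝ)) ≤ 1 - 1 / ((m + 1 : ℕ) : ℝ) := by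
    have h2 := Real.add_one_le_exp (1 / m : ℝ)
    have h3 : 1 - 1 / ((m + 1 : ℕ) : ℝ) = (1 / m + 1 : ℝ)⁻¹ := by
      push_cast; field_simp; ring
    rw [Real.exp_neg, h3]
    exact inv_anti₀ (by positivity) h2
  have h4 : (1 / 2 : ℝ) ≤ (1 - 1 / ((m + 1 : ℕ) : ℝ)) ^ d := by
    refine le_trans ?_ (pow_le_pow_left₀ (Real.exp_pos _).le h1 d)
    rw [← Real.exp_nat_mul]
    have : (1 / 2 : ℝ) = Real.exp (-Real.log 2) := by
      rw [Real.exp_neg, Real.exp_log two_pos, one_div]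
    rw [this, Real.exp_le_exp]
    rw [div_le_iff₀ hl] at hceil
    have : (d : ℝ) / m ≤ Real.log 2 := by rw [div_le_iff₀ hm0]; linarith
    calc -Real.log 2 ≤ -(d / m : ℝ) := by linarith
      _ = _ := by ring
  have h5 : (0 : ℝ) < 1 - (1 - 1 / ((m + 1 : ℕ) : ℝ)) ^ d := by
    have h6 : 0 < 1 / ((m + 1 : ℕ) : ℝ) := by positivity
    have h7 : 1 / ((m + 1 : ℕ) : ℝ) ≤ 1 := by
      rw [div_le_one (by positivity)]; push_cast; linarith
    have := pow_lt_one₀ (by linarith) (by linarith : 1 - 1 / ((m + 1 : ℕ) : ℝ) < 1)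
      (by omega : d ≠ 0)
    linarith
  have h8 : Real.log (1 - (1 - 1 / ((m + 1 : ℕ) : ℝ)) ^ d) ≤ Real.log 2⁻¹ :=
    Real.log_le_log h5 (by linarith)
  rw [Real.log_inv] at h8
  linarith

/-! ### The probability of disjunctness -/

open scoped Classical in
lemma utdProb_eq_card_filter (k n q : ℕ) (E : Matrix (Fin k × Fin q) (Fin n) Bool → Prop) :
    utdProb k n q E = ((Finset.univ.filter fun M' : Matrix (Fin k) (Fin n) (Fin q) =>
      E (toBinary M')).card : ℝ) / ((q : ℝ) ^ n) ^ k := by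
  unfold utdProb
  congr 1
  · rw [Nat.card_eq_fintype_card, Fintype.card_subtype]
  · simp [Matrix, Nat.card_eq_fintype_card]

/-- Union bound for the failure probabilities. -/
theorem one_sub_le_utdProb {ι : Type*} {k n q : ℕ} (hq : 0 < q) (s : Finset ι)
    {E : ι → Matrix (Fin k × Fin q) (Fin n) Bool → Prop}
    {F : Matrix (Fin k × Fin q) (Fin n) Bool → Prop} {ε : ℝ}
    (h : ∀ M, (∀ i ∈ s, E i M) → F M) (hE : ∀ i ∈ s, 1 - ε ≤ utdProb k n q (E i)) :
    1 - s.card * ε ≤ utdProb k n q F := by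
  classical
  have hpos : (0 : ℝ) < ((q : ℝ) ^ n) ^ k := by positivity
  have hcompl : ∀ G : Matrix (Fin k × Fin q) (Fin n) Bool → Prop,
      ((Finset.univ.filter fun M' : Matrix (Fin k) (Fin n) (Fin q) => ¬ G (toBinary M')).card : ℝ)
        = (1 - utdProb k n q G) * ((q : ℝ) ^ n) ^ k := by
    intro G
    have h1 := Finset.card_filter_add_card_filter_not
      (s := (Finset.univ : Finset (Matrix (Fin k) (Fin n) (Fin q)))) (fun M' => G (toBinary M'))
    have h2 : (Finset.univ : Finset (Matrix (Fin k) (Fin n) (Fin q))).card = (q ^ n) ^ k := by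
      rw [Finset.card_univ, ← Nat.card_eq_fintype_card]
      simp [Matrix]
    rw [h2] at h1
    have h3 := congrArg (fun n : ℕ => (n : ℝ)) h1
    push_cast at h3
    rw [utdProb_eq_card_filter, sub_mul, div_mul_cancel₀ _ hpos.ne']
    linarith
  have hsub : (Finset.univ.filter fun M' : Matrix (Fin k) (Fin n) (Fin q) => ¬ F (toBinary M')) ⊆
      s.biUnion fun i => Finset.univ.filter fun M' => ¬ E i (toBinary M') := by
    intro M' hM
    simp only [Finset.mem_filter, Finset.mem_univ, true_and, Finset.mem_biUnion] at hM ⊢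
    by_contra! hc
    exact hM (h _ hc)
  have h1 : ((Finset.univ.filter fun M' : Matrix (Fin k) (Fin n) (Fin q) =>
      ¬ F (toBinary M')).card : ℝ) ≤ ∑ i ∈ s, ((Finset.univ.filter
        fun M' : Matrix (Fin k) (Fin n) (Fin q) => ¬ E i (toBinary M')).card : ℝ) := by
    exact_mod_cast (Finset.card_le_card hsub).trans Finset.card_biUnion_le
  simp only [hcompl, ← Finset.sum_mul] at h1
  have h2 := le_of_mul_le_mul_right h1 hpos
  have h3 : ∑ i ∈ s, (1 - utdProb k n q (E i)) ≤ s.card * ε := by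
    rw [← nsmul_eq_mul]
    exact Finset.sum_le_card_nsmul _ _ _ fun i hi => by linarith [hE i hi]
  linarith

lemma utdProb_mono {k n q : ℕ} (hq : 0 < q)
    {E F : Matrix (Fin k × Fin q) (Fin n) Bool → Prop} (h : ∀ M, E M → F M) :
    utdProb k n q E ≤ utdProb k n q F := by
  have := one_sub_le_utdProb (k := k) (n := n) hq {()} (E := fun _ => E) (F := F)
    (ε := 1 - utdProb k n q E) (fun M hM => h M (hM () (by simp))) (fun _ _ => by simp)
  simpa using this

lemma isDisjunct_toBinary_iff {k n q : ℕ} (M' : Matrix (Fin k) (Fin n) (Fin q))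
    (I : Finset (Fin n)) :
    IsDisjunct (toBinary M') I ↔ ∀ i, i ∉ I → ∃ r, ∀ j ∈ I, M' r j ≠ M' r i := by
  simp only [IsDisjunct, toBinary, Prod.exists, decide_eq_true_eq, decide_eq_false_iff_not]
  refine forall₂_congr fun i _ => exists_congr fun r => ?_
  constructor
  · rintro ⟨σ, rfl, h⟩
    exact h
  · exact fun h => ⟨_, rfl, h⟩

/-- A matrix is split into its rows restricted to `I` (with `I` enumerated by `φ`) and its
columns outside `I`. -/
def splitColumns {k n q d : ℕ} (I : Finset (Fin n)) (φ : Fin d ≃ I) :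
    Matrix (Fin k) (Fin n) (Fin q) ≃
      (Fin k → Fin d → Fin q) × ({i // i ∉ I} → Fin k → Fin q) where
  toFun M := (fun r j => M r (φ j), fun i r => M r i)
  invFun p := fun r i => if h : i ∈ I then p.1 r (φ.symm ⟨i, h⟩) else p.2 ⟨i, h⟩ r
  left_inv M := by
    funext r i
    by_cases h : i ∈ I <;> simp [h]
  right_inv p := by
    refine Prod.ext ?_ ?_
    · funext r j; simp
    · funext i r; simp [i.2]

@[simp]
lemma splitColumns_fst {k n q d : ℕ} (I : Finset (Fin n)) (φ : Fin d ≃ I)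
    (M : Matrix (Fin k) (Fin n) (Fin q)) (r : Fin k) (j : Fin d) :
    (splitColumns I φ M).1 r j = M r (φ j) := rfl

@[simp]
lemma splitColumns_snd {k n q d : ℕ} (I : Finset (Fin n)) (φ : Fin d ≃ I)
    (M : Matrix (Fin k) (Fin n) (Fin q)) (i : {i // i ∉ I}) (r : Fin k) :
    (splitColumns I φ M).2 i r = M r i := rfl

/-- Given the restrictions `A r` of the rows to `I`, the items outside `I` are eliminated
independently, each with probability `1 - ∏ r, D (A r) / q`. -/
theorem utdProb_isDisjunct_eq {k n q d : ℕ} (hq : 0 < q) (I : Finset (Fin n)) (hI : I.card = d) :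
    utdProb k n q (fun M => IsDisjunct M I) =
      (∑ A : Fin k → Fin d → Fin q, (1 - ∏ r, (distinct (A r) : ℝ) / q) ^ (n - d)) /
        ((q : ℝ) ^ d) ^ k := by
  classical
  have hq0 : (0 : ℝ) < q := by exact_mod_cast hq
  have hdn : d ≤ n := by
    rw [← hI]; simpa using Finset.card_le_univ I
  let φ : Fin d ≃ I := (I.equivFinOfCardEq hI).symm
  -- The columns that are eliminated when the rows restricted to `I` are given by `A`.
  let good (A : Fin k → Fin d → Fin q) : Finset (Fin k → Fin q) :=
    Finset.univ.filter fun b => ∃ r, b r ∉ Finset.univ.image (A r)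
  have hmem : ∀ A b, b ∈ good A ↔ ∃ r, ∀ j, A r j ≠ b r := fun A b => by simp [good]
  have hgood : ∀ A, ((good A).card : ℝ) = q ^ k * (1 - ∏ r, (distinct (A r) : ℝ) / q) := by
    intro A
    have h1 := Finset.card_filter_add_card_filter_not
      (s := (Finset.univ : Finset (Fin k → Fin q))) (fun b => ∃ r, b r ∉ Finset.univ.image (A r))
    have h2 : (Finset.univ.filter fun b : Fin k → Fin q =>
        ¬ ∃ r, b r ∉ Finset.univ.image (A r)) =
        Fintype.piFinset fun r => Finset.univ.image (A r) := by
      ext b; simp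
    rw [h2, Fintype.card_piFinset] at h1
    have h3 : (good A).card + ∏ r, distinct (A r) = q ^ k := by
      simpa [good, distinct] using h1
    have h4 := congrArg (fun n : ℕ => (n : ℝ)) h3
    push_cast at h4
    have h5 : ∏ r, (distinct (A r) : ℝ) / q = (∏ r, (distinct (A r) : ℝ)) / q ^ k := by
      rw [Finset.prod_div_distrib]; simp
    rw [h5, mul_sub, mul_div_cancel₀ _ (by positivity)]
    linarith
  have hcount : (Finset.univ.filter fun M' : Matrix (Fin k) (Fin n) (Fin q) =>
      IsDisjunct (toBinary M') I).card = ∑ A, (good A).card ^ (n - d) := by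
    have h1 : ∀ M' : Matrix (Fin k) (Fin n) (Fin q), IsDisjunct (toBinary M') I ↔
        ∀ i, (splitColumns I φ M').2 i ∈ good (splitColumns I φ M').1 := by
      intro M'
      rw [isDisjunct_toBinary_iff, Subtype.forall]
      refine forall₂_congr fun i _ => ?_
      simp only [hmem, splitColumns_fst, splitColumns_snd]
      refine exists_congr fun r => ?_
      constructor
      · exact fun h j => h _ (φ j).2
      · intro h j hj
        simpa using h (φ.symm ⟨j, hj⟩)
    rw [Finset.card_filter]
    simp only [h1]
    rw [Equiv.sum_comp (splitColumns I φ) (fun p => if ∀ i, p.2 i ∈ good p.1 then 1 else 0),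
      Fintype.sum_prod_type]
    refine Finset.sum_congr rfl fun A _ => ?_
    rw [← Finset.card_filter]
    have h2 : (Finset.univ.filter fun B : {i // i ∉ I} → Fin k → Fin q => ∀ i, B i ∈ good A) =
        Fintype.piFinset fun _ => good A := by
      ext B; simp
    rw [h2, Fintype.card_piFinset, Finset.prod_const, Finset.card_univ]
    congr 1
    simp [Fintype.card_subtype_compl, hI]
  have hsplit : ((q : ℝ) ^ n) ^ k = (q ^ d) ^ k * (q ^ k) ^ (n - d) := by
    rw [← pow_mul, ← pow_mul, ← pow_mul, ← pow_add]
    congr 1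
    obtain ⟨e, rfl⟩ := Nat.exists_eq_add_of_le hdn
    rw [Nat.add_sub_cancel_left]
    ring
  rw [utdProb_eq_card_filter, hcount, hsplit]
  push_cast
  simp only [hgood, mul_pow]
  rw [← Finset.mul_sum]
  field_simp

/-- The average of `(D / q) ^ t` over all strings in `[q]^d`. -/
noncomputable def moment (q d : ℕ) (t : ℝ) : ℝ :=
  (∑ v : Fin d → Fin q, ((distinct v : ℝ) / q) ^ t) / (q : ℝ) ^ d

lemma moment_pow (q d k : ℕ) (t : ℝ) :
    moment q d t ^ k =
      (∑ A : Fin k → Fin d → Fin q, (∏ r, (distinct (A r) : ℝ) / q) ^ t) / ((q : ℝ) ^ d) ^ k := by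
  rw [moment, div_pow, Fintype.sum_pow]
  congr 1
  refine Finset.sum_congr rfl fun A _ => ?_
  rw [Real.finsetProd_rpow _ _ fun r _ => by positivity]

lemma prod_distinct_mem {q d k : ℕ} (hq : 0 < q) (hd : 1 ≤ d) (A : Fin k → Fin d → Fin q) :
    0 < ∏ r, (distinct (A r) : ℝ) / q ∧ ∏ r, (distinct (A r) : ℝ) / q ≤ 1 := by
  have hq0 : (0 : ℝ) < q := by exact_mod_cast hq
  constructor
  · refine Finset.prod_pos fun r _ => div_pos ?_ hq0
    exact_mod_cast one_le_distinct hd (A r)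
  · refine Finset.prod_le_one (fun r _ => by positivity) fun r _ => ?_
    exact div_le_one_of_le₀ (by exact_mod_cast distinct_le_alphabet _) hq0.le

/-- The failure probability is at most a moment of the expected number of items that are not
eliminated. -/
theorem one_sub_le_utdProb_isDisjunct {k n q d : ℕ} (hq : 0 < q) (hd : 1 ≤ d)
    (I : Finset (Fin n)) (hI : I.card = d) {t : ℝ} (ht0 : 0 < t) (ht1 : t ≤ 1) :
    1 - (n : ℝ) ^ t * moment q d t ^ k ≤ utdProb k n q (fun M => IsDisjunct M I) := by
  have hq0 : (0 : ℝ) < q := by exact_mod_cast hq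
  have hone : (1 : ℝ) = (∑ _A : Fin k → Fin d → Fin q, (1 : ℝ)) / ((q : ℝ) ^ d) ^ k := by
    simp [hq0.ne']
  rw [utdProb_isDisjunct_eq hq I hI, moment_pow, hone, ← mul_div_assoc, ← sub_div,
    Finset.mul_sum, ← Finset.sum_sub_distrib]
  refine div_le_div_of_nonneg_right (Finset.sum_le_sum fun A _ => ?_) (by positivity)
  obtain ⟨h0, h1⟩ := prod_distinct_mem hq hd A
  generalize ∏ r, (distinct (A r) : ℝ) / q = y at *
  rw [← Real.mul_rpow (Nat.cast_nonneg n) h0.le, ← hone]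
  -- `1 - (1 - y) ^ (n - d)` is at most `1` and at most `n y`, hence at most `(n y) ^ t`.
  rcases le_total 1 ((n : ℝ) * y) with h | h
  · have := Real.one_le_rpow h ht0.le
    have : 0 ≤ (1 - y) ^ (n - d) := pow_nonneg (by linarith) _
    linarith
  · have h2 := Real.rpow_le_rpow_of_exponent_ge_of_imp (x := (n : ℝ) * y) (y := 1) (z := t)
      (by positivity) h ht1 (fun _ h => absurd h one_ne_zero)
    rw [Real.rpow_one] at h2
    have h3 := one_add_mul_le_pow (a := -y) (by linarith) (n - d)
    have h4 : ((n - d : ℕ) : ℝ) * y ≤ n * y :=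
      mul_le_mul_of_nonneg_right (by exact_mod_cast Nat.sub_le n d) h0.le
    rw [← sub_eq_add_neg] at h3
    linarith

/-- The success probability is at most a negative moment of the expected number of items that are
not eliminated, because `(1 - y) ^ N ≤ exp (-(N y)) ≤ (N y) ^ (-t)`. -/
theorem utdProb_isDisjunct_le {k n q d : ℕ} (hq : 0 < q) (hd : 1 ≤ d) (hdn : d < n)
    (I : Finset (Fin n)) (hI : I.card = d) {t : ℝ} (ht0 : 0 < t) (ht1 : t ≤ 1) :
    utdProb k n q (fun M => IsDisjunct M I) ≤ ((n - d : ℕ) : ℝ) ^ (-t) * moment q d (-t) ^ k := by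
  rw [utdProb_isDisjunct_eq hq I hI, moment_pow, ← mul_div_assoc, Finset.mul_sum]
  refine div_le_div_of_nonneg_right (Finset.sum_le_sum fun A _ => ?_) (by positivity)
  obtain ⟨h0, h1⟩ := prod_distinct_mem hq hd A
  have hN : (0 : ℝ) < (n - d : ℕ) := by exact_mod_cast (by omega : 0 < n - d)
  generalize ∏ r, (distinct (A r) : ℝ) / q = y at *
  generalize n - d = N at *
  rw [← Real.mul_rpow hN.le h0.le]
  have hu : 0 < (N : ℝ) * y := by positivity
  calc (1 - y) ^ N ≤ Real.exp (-y) ^ N := by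
        refine pow_le_pow_left₀ (by linarith) ?_ N
        linarith [Real.add_one_le_exp (-y)]
    _ = Real.exp (-(N * y)) := by rw [← Real.exp_nat_mul]; congr 1; ring
    _ ≤ _ := by
      rw [Real.exp_neg, Real.rpow_neg hu.le]
      refine inv_anti₀ (by positivity) ?_
      rcases le_total 1 ((N : ℝ) * y) with h | h
      · have := Real.rpow_le_rpow_of_exponent_le h ht1
        rw [Real.rpow_one] at this
        linarith [Real.add_one_le_exp ((N : ℝ) * y)]
      · exact (Real.rpow_le_one hu.le h ht0.le).trans (Real.one_le_exp hu.le)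

/-- Sets of at most `d` items reduce to sets of exactly `d` items: `I` is the intersection of two
sets of `d` items, and an item outside `I` is outside one of them. -/
theorem utdProb_isDisjunct_of_card_eq {k n q d : ℕ} (hq : 0 < q) (hn : 2 * d ≤ n) {ε : ℝ}
    (hε : 0 ≤ ε)
    (h : ∀ I : Finset (Fin n), I.card = d → 1 - ε ≤ utdProb k n q (fun M => IsDisjunct M I))
    (I : Finset (Fin n)) (hI : I.card ≤ d) :
    1 - 2 * ε ≤ utdProb k n q (fun M => IsDisjunct M I) := by
  classical
  obtain ⟨I₁, hII₁, -, hI₁⟩ := Finset.exists_subsuperset_card_eq (Finset.subset_univ I) hI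
    (by simp; omega)
  have hc : I.card + (I₁ᶜ).card ≥ d := by
    rw [Finset.card_compl, Fintype.card_fin]; omega
  obtain ⟨I₂, hII₂, hI₂sub, hI₂⟩ := Finset.exists_subsuperset_card_eq (s := I) (t := I ∪ I₁ᶜ)
    (n := d) Finset.subset_union_left hI (by
      rw [Finset.card_union_of_disjoint]
      · exact hc
      · exact disjoint_compl_right.mono_left hII₁)
  have := one_sub_le_utdProb (k := k) hq {I₁, I₂} (E := fun J M => IsDisjunct M J)
    (F := fun M => IsDisjunct M I) (ε := ε) ?_ ?_
  · have h2 : ((({I₁, I₂} : Finset (Finset (Fin n))).card : ℕ) : ℝ) ≤ 2 := by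
      exact_mod_cast Finset.card_le_two
    nlinarith
  · intro M hM i hi
    have key : ∀ J : Finset (Fin n), I ⊆ J → IsDisjunct M J → i ∉ J →
        ∃ t, M t i = true ∧ ∀ j ∈ I, M t j = false := by
      intro J hIJ hJ hiJ
      obtain ⟨t, ht, h⟩ := hJ i hiJ
      exact ⟨t, ht, fun j hj => h j (hIJ hj)⟩
    by_cases hi₁ : i ∈ I₁
    · refine key I₂ hII₂ (hM I₂ (by simp)) fun hi₂ => ?_
      have := hI₂sub hi₂
      simp [hi, hi₁] at this
    · exact key I₁ hII₁ (hM I₁ (by simp)) hi₁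
  · intro J hJ
    simp only [Finset.mem_insert, Finset.mem_singleton] at hJ
    rcases hJ with rfl | rfl
    · exact h _ hI₁
    · exact h _ hI₂

/-! ### Separability and disjunctness -/

/-- Disjunctness for `I` excludes the sets `J` that are not contained in `I`, and disjunctness for
`I \ {j}` excludes the subsets of `I` that omit `j`. -/
theorem isSeparable_of_isDisjunct {ρ : Type*} {n : ℕ} (d : ℕ) (M : Matrix ρ (Fin n) Bool)
    (I : Finset (Fin n)) (h : IsDisjunct M I) (h' : ∀ j ∈ I, IsDisjunct M (I.erase j)) :
    IsSeparable d M I := by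
  intro J _ hJI heq
  have hans : ∀ t, (∃ i ∈ J, M t i = true) ↔ ∃ i ∈ I, M t i = true := by
    intro t
    have := congrFun heq t
    simpa [answers] using this
  by_cases hsub : J ⊆ I
  · obtain ⟨j, hjI, hjJ⟩ := Finset.exists_of_ssubset (hsub.ssubset_of_ne hJI)
    obtain ⟨t, htj, ht⟩ := h' j hjI j (Finset.notMem_erase j I)
    obtain ⟨i, hiJ, hi⟩ := (hans t).2 ⟨j, hjI, htj⟩
    have hne : i ≠ j := fun e => hjJ (e ▸ hiJ)
    have := ht i (Finset.mem_erase.2 ⟨hne, hsub hiJ⟩)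
    simp [hi] at this
  · obtain ⟨i, hiJ, hiI⟩ := Finset.not_subset.1 hsub
    obtain ⟨t, hti, ht⟩ := h i hiI
    obtain ⟨j, hj, htj⟩ := (hans t).1 ⟨i, hiJ, hti⟩
    simp [ht j hj] at htj

/-- If `I` has fewer than `d` items, separability distinguishes `I` from `I ∪ {i}`. -/
theorem isDisjunct_of_isSeparable {ρ : Type*} {n d : ℕ} {M : Matrix ρ (Fin n) Bool}
    {I : Finset (Fin n)} (hI : I.card < d) (h : IsSeparable d M I) : IsDisjunct M I := by
  intro i hi
  by_contra! hc
  refine h (insert i I) (by rw [Finset.card_insert_of_notMem hi]; omega)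
    (fun e => hi (e ▸ Finset.mem_insert_self i I)) ?_
  funext t
  simp only [answers, decide_eq_decide, Finset.mem_insert, exists_eq_or_imp, or_iff_right_iff_imp]
  intro hti
  obtain ⟨j, hj, hjt⟩ := hc t hti
  exact ⟨j, hj, by simpa using hjt⟩

/-! ### Moments of small order and the threshold for disjunctness -/

lemma moment_zero {q : ℕ} (hq : 0 < q) (d : ℕ) : moment q d 0 = 1 := by
  have : (q : ℝ) ≠ 0 := by exact_mod_cast hq.ne'
  simp [moment, this]

lemma moment_nonneg (q d : ℕ) (t : ℝ) : 0 ≤ moment q d t := by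
  unfold moment
  exact div_nonneg (Finset.sum_nonneg fun v _ => by positivity) (by positivity)

theorem hasDerivAt_moment {q d : ℕ} (hq : 0 < q) (hd : 1 ≤ d) :
    HasDerivAt (moment q d) (-rate q d) 0 := by
  have hq0 : (0 : ℝ) < q := by exact_mod_cast hq
  have h : HasDerivAt (fun t : ℝ => ∑ v : Fin d → Fin q, ((distinct v : ℝ) / q) ^ t)
      (∑ v : Fin d → Fin q, Real.log ((distinct v : ℝ) / q)) 0 := by
    refine HasDerivAt.fun_sum fun v _ => ?_
    have hv : (0 : ℝ) < (distinct v : ℝ) / q :=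
      div_pos (by exact_mod_cast one_le_distinct hd v) hq0
    have := (Real.hasStrictDerivAt_const_rpow hv 0).hasDerivAt
    simpa using this
  have h2 := h.div_const ((q : ℝ) ^ d)
  have h3 : -rate q d = (∑ v : Fin d → Fin q, Real.log ((distinct v : ℝ) / q)) / (q : ℝ) ^ d := by
    rw [rate, Finset.sum_neg_distrib]; ring
  rw [h3]
  exact h2

lemma exists_lt_of_deriv_neg {g : ℝ → ℝ} {g' : ℝ} (h : HasDerivAt g g' 0) (hg : g' < 0) :
    ∃ t, 0 < t ∧ t ≤ 1 ∧ g t < g 0 := by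
  have h1 := h.tendsto_slope_zero_right.eventually (gt_mem_nhds hg)
  have h2 : ∀ᶠ t in 𝓝[>] (0 : ℝ), t ∈ Set.Ioc (0 : ℝ) 1 := Ioc_mem_nhdsGT one_pos
  obtain ⟨t, ht, ht0, ht1⟩ := (h1.and h2).exists
  refine ⟨t, ht0, ht1, ?_⟩
  rw [zero_add, smul_eq_mul, inv_mul_eq_div, div_neg_iff] at ht
  rcases ht with ht | ht <;> linarith

lemma exists_moment_le {q d : ℕ} (hq : 0 < q) (hd : 1 ≤ d) {l : ℝ} (hl : l < rate q d) :
    ∃ t, 0 < t ∧ t ≤ 1 ∧ moment q d t ≤ Real.exp (-(l * t)) := by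
  have h1 : HasDerivAt (fun t => Real.exp (-(l * t))) (-l) 0 := by
    simpa using (((hasDerivAt_id (0 : ℝ)).const_mul l).neg).exp
  obtain ⟨t, ht0, ht1, ht⟩ := exists_lt_of_deriv_neg ((hasDerivAt_moment hq hd).sub h1)
    (by linarith)
  refine ⟨t, ht0, ht1, ?_⟩
  simp only [Pi.sub_apply, moment_zero hq] at ht
  simp only [mul_zero, neg_zero, Real.exp_zero, sub_self] at ht
  linarith

lemma exists_moment_neg_le {q d : ℕ} (hq : 0 < q) (hd : 1 ≤ d) {l : ℝ} (hl : rate q d < l) :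
    ∃ t, 0 < t ∧ t ≤ 1 ∧ moment q d (-t) ≤ Real.exp (l * t) := by
  have h1 : HasDerivAt (fun t => Real.exp (l * t)) l 0 := by
    simpa using ((hasDerivAt_id (0 : ℝ)).const_mul l).exp
  have h2 : HasDerivAt (fun t => moment q d (-t)) (rate q d) 0 := by
    have h := hasDerivAt_moment hq hd
    rw [← neg_zero] at h
    have h' := h.comp (0 : ℝ) (hasDerivAt_neg (0 : ℝ))
    rw [neg_mul_neg, mul_one] at h'
    exact h'
  obtain ⟨t, ht0, ht1, ht⟩ := exists_lt_of_deriv_neg (h2.sub h1) (by linarith)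
  refine ⟨t, ht0, ht1, ?_⟩
  simp only [Pi.sub_apply, neg_zero, moment_zero hq] at ht
  simp only [mul_zero, Real.exp_zero, sub_self] at ht
  linarith

lemma moment_neg_one_le {q d : ℕ} (hq : 0 < q) (hd : 1 ≤ d) : moment q d (-1) ≤ q := by
  have hq0 : (0 : ℝ) < q := by exact_mod_cast hq
  rw [moment, div_le_iff₀ (by positivity)]
  refine (Finset.sum_le_card_nsmul _ _ (q : ℝ) fun v _ => ?_).trans (le_of_eq ?_)
  · have hv : (1 : ℝ) ≤ distinct v := by exact_mod_cast one_le_distinct hd v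
    rw [Real.rpow_neg_one, inv_div]
    exact div_le_self hq0.le hv
  · simp [mul_comm]

lemma tendsto_log_natCast : Tendsto (fun n : ℕ => Real.log n) atTop atTop :=
  Real.tendsto_log_atTop.comp tendsto_natCast_atTop_atTop

lemma exists_forall_le_div_log (M : ℝ) :
    ∃ Q : ℕ, ∀ q : ℕ, Q ≤ q → 2 ≤ q → M ≤ q / Real.log q := by
  have h := (Real.isLittleO_log_id_atTop.comp_tendsto
    (tendsto_natCast_atTop_atTop (R := ℝ))).def (c := 1 / (|M| + 1)) (by positivity)
  obtain ⟨Q, hQ⟩ := eventually_atTop.1 h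
  refine ⟨Q, fun q hq h2 => ?_⟩
  have h3 := hQ q hq
  have hl : 0 < Real.log q := Real.log_pos (by exact_mod_cast h2)
  simp only [Function.comp_apply, id, Real.norm_eq_abs, abs_of_pos hl, Nat.abs_cast] at h3
  rw [one_div_mul_eq_div, le_div_iff₀ (by positivity)] at h3
  rw [le_div_iff₀ hl]
  nlinarith [le_abs_self M]

/-- The least value of `q / rate q d` over all alphabet sizes `q ≥ 2`. -/
noncomputable def threshold (d : ℕ) : ℝ :=
  sInf {x : ℝ | ∃ q : ℕ, 2 ≤ q ∧ x = (q : ℝ) / rate q d}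

/-- The minimum is attained because `q / rate q d ≥ q / log q` tends to infinity. -/
theorem isLeast_threshold {d : ℕ} (hd : 1 ≤ d) :
    IsLeast {x : ℝ | ∃ q : ℕ, 2 ≤ q ∧ x = (q : ℝ) / rate q d} (threshold d) := by
  obtain ⟨Q, hQ⟩ := exists_forall_le_div_log (2 / rate 2 d)
  obtain ⟨q₀, hq₀, hmin⟩ := Finset.exists_min_image (Finset.Icc 2 (max 2 Q))
    (fun q : ℕ => (q : ℝ) / rate q d) ⟨2, by simp⟩
  rw [Finset.mem_Icc] at hq₀
  have h : IsLeast {x : ℝ | ∃ q : ℕ, 2 ≤ q ∧ x = (q : ℝ) / rate q d} (q₀ / rate q₀ d) := by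
    refine ⟨⟨q₀, hq₀.1, rfl⟩, ?_⟩
    rintro _ ⟨q, hq, rfl⟩
    rcases le_total q (max 2 Q) with h | h
    · exact hmin q (Finset.mem_Icc.2 ⟨hq, h⟩)
    · have h2 := hmin 2 (by simp)
      have h3 := hQ q (le_trans (le_max_right _ _) h) hq
      have h4 : (q : ℝ) / Real.log q ≤ q / rate q d :=
        div_le_div_of_nonneg_left (Nat.cast_nonneg q) (rate_pos hq hd) (rate_le_log hq hd)
      push_cast at h2
      linarith
  unfold threshold
  rwa [h.csInf_eq]

/-- Achievability: any `C > q / rate q d` gives enough tests with the alphabet size `q`. -/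
theorem eventually_exists_isDisjunct {q d : ℕ} (hq : 2 ≤ q) (hd : 1 ≤ d) {C : ℝ}
    (hC : q / rate q d < C) {ε : ℝ} (hε : 0 < ε) :
    ∀ᶠ n : ℕ in atTop, ∃ k : ℕ, ((q * k : ℕ) : ℝ) ≤ C * Real.log n ∧ q ≤ n ∧
      ∀ I : Finset (Fin n), I.card ≤ d → 1 - ε ≤ utdProb k n q (fun M => IsDisjunct M I) := by
  have hq0 : (0 : ℝ) < q := by positivity
  have hr := rate_pos hq hd
  obtain ⟨C', hC1, hC2⟩ := exists_between hC
  have hC'0 : 0 < C' := lt_trans (by positivity) hC1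
  obtain ⟨l, hl1, hl2⟩ := exists_between (show q / C' < rate q d by
    rw [div_lt_iff₀ hr] at hC1
    rw [div_lt_iff₀ hC'0]
    linarith)
  have hl0 : 0 < l := lt_trans (by positivity) hl1
  obtain ⟨t, ht0, ht1, ht⟩ := exists_moment_le (by omega) hd hl2
  have hs : 0 < t * (l * C' / q - 1) := by
    refine mul_pos ht0 (sub_pos.2 ?_)
    rw [lt_div_iff₀ hq0, one_mul]
    rwa [div_lt_iff₀ hC'0] at hl1
  have e1 : ∀ᶠ n : ℕ in atTop, Real.exp (-(t * (l * C' / q - 1) * Real.log n)) ≤ ε / 2 := by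
    have h := (Real.tendsto_exp_neg_atTop_nhds_zero.comp
      (tendsto_log_natCast.const_mul_atTop hs)).eventually (ge_mem_nhds (half_pos hε))
    exact h
  have e2 : ∀ᶠ n : ℕ in atTop, (q : ℝ) / (C - C') ≤ Real.log n :=
    tendsto_log_natCast.eventually_ge_atTop _
  filter_upwards [e1, e2, eventually_ge_atTop q, eventually_ge_atTop (2 * d),
    eventually_ge_atTop 1] with n h1 h2 h3 h4 h5
  have hn0 : (0 : ℝ) < n := by exact_mod_cast h5
  have hlog : 0 ≤ Real.log n := Real.log_nonneg (by exact_mod_cast h5)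
  refine ⟨⌈C' / q * Real.log n⌉₊, ?_, h3, ?_⟩
  · have h6 := (Nat.ceil_lt_add_one (show 0 ≤ C' / q * Real.log n by positivity)).le
    rw [div_le_iff₀ (by linarith)] at h2
    push_cast
    calc (q : ℝ) * ⌈C' / q * Real.log n⌉₊ ≤ q * (C' / q * Real.log n + 1) := by gcongr
      _ = C' * Real.log n + q := by field_simp
      _ ≤ _ := by linarith
  · have h6 := Nat.le_ceil (C' / q * Real.log n)
    generalize ⌈C' / q * Real.log n⌉₊ = k at *
    intro I hI
    have h7 : (n : ℝ) ^ t * moment q d t ^ k ≤ ε / 2 := by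
      refine le_trans ?_ h1
      calc (n : ℝ) ^ t * moment q d t ^ k
          ≤ Real.exp (Real.log n * t) * Real.exp (-(l * t)) ^ k := by
            rw [Real.rpow_def_of_pos hn0]
            gcongr
            exact moment_nonneg q d t
        _ = Real.exp (Real.log n * t - l * t * k) := by
            rw [← Real.exp_nat_mul, ← Real.exp_add]; congr 1; ring
        _ ≤ _ := by
            rw [Real.exp_le_exp]
            have h8 := mul_le_mul_of_nonneg_left h6 (mul_pos hl0 ht0).le
            have h9 : l * t * (C' / q * Real.log n) = t * (l * C' / q) * Real.log n := by ring
            linarith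
    have := utdProb_isDisjunct_of_card_eq (k := k) (by omega : 0 < q) h4 (half_pos hε).le
      (fun J hJ => le_trans (by linarith)
        (one_sub_le_utdProb_isDisjunct (by omega : 0 < q) hd J hJ ht0 ht1)) I hI
    linarith

/-- A bound for the moment of order `-t` turns a success probability into a lower bound for the
number of rows. -/
lemma log_le_mul_rows {k n q d : ℕ} (hq : 0 < q) (hd : 1 ≤ d) (hdn : d < n) {δ : ℝ} (hδ : δ < 1)
    (h : ∀ I : Finset (Fin n), I.card ≤ d → 1 - δ ≤ utdProb k n q (fun M => IsDisjunct M I))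
    {l t : ℝ} (ht0 : 0 < t) (ht1 : t ≤ 1) (ht : moment q d (-t) ≤ Real.exp (l * t)) :
    Real.log (n - d : ℕ) + Real.log (1 - δ) / t ≤ l * k := by
  have hN : (0 : ℝ) < (n - d : ℕ) := by exact_mod_cast (by omega : 0 < n - d)
  obtain ⟨I, -, hI⟩ := Finset.exists_subset_card_eq (s := (Finset.univ : Finset (Fin n)))
    (n := d) (by simp; omega)
  have h1 := (h I hI.le).trans (utdProb_isDisjunct_le hq hd hdn I hI ht0 ht1)
  have h2 : 1 - δ ≤ Real.exp (-(Real.log (n - d : ℕ) * t) + l * t * k) := by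
    refine h1.trans ?_
    calc ((n - d : ℕ) : ℝ) ^ (-t) * moment q d (-t) ^ k
        ≤ Real.exp (Real.log (n - d : ℕ) * -t) * Real.exp (l * t) ^ k := by
          rw [Real.rpow_def_of_pos hN]
          gcongr
          exact moment_nonneg q d (-t)
      _ = _ := by
          rw [← Real.exp_nat_mul, ← Real.exp_add]; congr 1; ring
  have h3 := Real.log_le_log (by linarith) h2
  rw [Real.log_exp] at h3
  rw [← le_sub_iff_add_le', div_le_iff₀ ht0]
  linarith

lemma eventually_mul_log_le {C a : ℝ} (ha : C < a) (ha0 : 0 < a) (d : ℕ) (B : ℝ) :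
    ∀ᶠ n : ℕ in atTop, C * Real.log n ≤ a * (Real.log (n - d : ℕ) + B) := by
  have e : ∀ᶠ n : ℕ in atTop, a * (Real.log 2 - B) / (a - C) ≤ Real.log n :=
    tendsto_log_natCast.eventually_ge_atTop _
  filter_upwards [e, eventually_ge_atTop (2 * d), eventually_ge_atTop 1] with n h1 h2 h3
  have hn0 : (0 : ℝ) < n := by exact_mod_cast h3
  have h4 : (n : ℝ) / 2 ≤ (n - d : ℕ) := by
    rw [div_le_iff₀ two_pos]
    exact_mod_cast (by omega : n ≤ (n - d) * 2)
  have h5 := Real.log_le_log (by positivity) h4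
  rw [Real.log_div hn0.ne' two_ne_zero] at h5
  rw [div_le_iff₀ (by linarith)] at h1
  have h6 := mul_le_mul_of_nonneg_left h5 ha0.le
  linarith

/-- Converse: fewer than `C log n` tests with `C < threshold d` do not suffice, whatever the
alphabet size. -/
theorem eventually_le_tests {d : ℕ} (hd : 1 ≤ d) {C δ : ℝ} (hC : C < threshold d) (hδ : δ < 1) :
    ∀ᶠ n : ℕ in atTop, ∀ q k : ℕ, 2 ≤ q →
      (∀ I : Finset (Fin n), I.card ≤ d → 1 - δ ≤ utdProb k n q (fun M => IsDisjunct M I)) →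
      C * Real.log n ≤ ((q * k : ℕ) : ℝ) := by
  obtain ⟨Q, hQ⟩ := exists_forall_le_div_log (|C| + 1)
  have hsmall : ∀ᶠ n : ℕ in atTop, ∀ q ∈ Finset.range Q, ∀ k : ℕ, 2 ≤ q →
      (∀ I : Finset (Fin n), I.card ≤ d → 1 - δ ≤ utdProb k n q (fun M => IsDisjunct M I)) →
      C * Real.log n ≤ ((q * k : ℕ) : ℝ) := by
    rw [eventually_all_finset]
    intro q _
    by_cases hq : 2 ≤ q
    swap
    · exact Eventually.of_forall fun n k h => absurd h hq
    have hq0 : (0 : ℝ) < q := by positivity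
    have hr := rate_pos hq hd
    have hCq : C < q / rate q d := hC.trans_le ((isLeast_threshold hd).2 ⟨q, hq, rfl⟩)
    obtain ⟨a, ha1, ha2⟩ := exists_between (max_lt hCq (show 0 < q / rate q d by positivity))
    have ha0 : 0 < a := (le_max_right _ _).trans_lt ha1
    obtain ⟨t, ht0, ht1, ht⟩ := exists_moment_neg_le (l := q / a) (by omega : 0 < q) hd (by
      rw [lt_div_iff₀ hr] at ha2
      rw [lt_div_iff₀ ha0]
      linarith)
    filter_upwards [eventually_mul_log_le ((le_max_left _ _).trans_lt ha1) ha0 d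
      (Real.log (1 - δ) / t), eventually_gt_atTop d] with n h1 h2 k _ h
    refine h1.trans ?_
    have := mul_le_mul_of_nonneg_left
      (log_le_mul_rows (by omega : 0 < q) hd h2 hδ h ht0 ht1 ht) ha0.le
    refine this.trans (le_of_eq ?_)
    push_cast
    field_simp
  have hpos : 0 < |C| + 1 := by positivity
  filter_upwards [hsmall, eventually_mul_log_le (by linarith [le_abs_self C] : C < |C| + 1) hpos d
    (Real.log (1 - δ) / 1), eventually_mul_log_le hpos hpos d (Real.log (1 - δ) / 1),
    eventually_gt_atTop d] with n h1 h2 h3 h4 q k hq h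
  by_cases hqQ : q < Q
  · exact h1 q (Finset.mem_range.2 hqQ) k hq h
  have hq0 : (0 : ℝ) < q := by positivity
  have hl : 0 < Real.log q := Real.log_pos (by exact_mod_cast hq)
  have h6 := log_le_mul_rows (l := Real.log q) (by omega : 0 < q) hd h4 hδ h one_pos le_rfl (by
    rw [mul_one, Real.exp_log hq0]
    exact moment_neg_one_le (by omega) hd)
  have h7 := hQ q (not_lt.1 hqQ) hq
  rw [zero_mul] at h3
  have h8 : 0 ≤ Real.log (n - d : ℕ) + Real.log (1 - δ) / 1 :=
    (mul_nonneg_iff_of_pos_left hpos).1 h3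
  calc C * Real.log n ≤ (|C| + 1) * (Real.log (n - d : ℕ) + Real.log (1 - δ) / 1) := h2
    _ ≤ q / Real.log q * (Real.log (n - d : ℕ) + Real.log (1 - δ) / 1) := by gcongr
    _ ≤ q / Real.log q * (Real.log q * k) := by gcongr
    _ = _ := by push_cast; field_simp

/-! ### Asymptotics of the number of tests -/

lemma eventually_log_pos : ∀ᶠ n : ℕ in atTop, 0 < Real.log n :=
  tendsto_log_natCast.eventually_gt_atTop 0

/-- For large `n`, some number of tests makes the design disjunct with probability `1 - δ`, and the
least such number is at most `C log n`. -/
theorem eventually_mDisjunct_le {δ C : ℝ} (hδ : 0 < δ) {d : ℕ} (hd : 1 ≤ d)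
    (hC : threshold d < C) :
    ∀ᶠ n : ℕ in atTop, {m : ℕ | ∃ q k : ℕ, 2 ≤ q ∧ q ≤ n ∧ m = q * k ∧
      ∀ I : Finset (Fin n), I.card ≤ d →
        1 - δ ≤ utdProb k n q (fun M => IsDisjunct M I)}.Nonempty ∧
      (mDisjunct δ n d : ℝ) ≤ C * Real.log n := by
  obtain ⟨q, hq, hqC⟩ := (isLeast_threshold hd).1
  filter_upwards [eventually_exists_isDisjunct hq hd (hqC ▸ hC) hδ] with n ⟨k, hk, hqn, h⟩
  have hmem : q * k ∈ {m : ℕ | ∃ q k : ℕ, 2 ≤ q ∧ q ≤ n ∧ m = q * k ∧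
      ∀ I : Finset (Fin n), I.card ≤ d →
        1 - δ ≤ utdProb k n q (fun M => IsDisjunct M I)} := ⟨q, k, hq, hqn, rfl, h⟩
  refine ⟨⟨_, hmem⟩, le_trans ?_ hk⟩
  exact_mod_cast Nat.sInf_le hmem

theorem tendsto_mDisjunct {δ : ℝ} (hδ0 : 0 < δ) (hδ1 : δ < 1) {d : ℕ} (hd : 1 ≤ d) :
    Tendsto (fun n : ℕ => (mDisjunct δ n d : ℝ) / Real.log n) atTop (𝓝 (threshold d)) := by
  refine tendsto_order.2 ⟨fun a ha => ?_, fun a ha => ?_⟩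
  · obtain ⟨C, hC1, hC2⟩ := exists_between ha
    filter_upwards [eventually_le_tests hd hC2 hδ1,
      eventually_mDisjunct_le hδ0 hd (lt_add_one (threshold d)), eventually_log_pos]
      with n h1 h2 h3
    obtain ⟨q, k, hq, -, hm, h⟩ := Nat.sInf_mem h2.1
    have h4 := h1 q k hq h
    rw [lt_div_iff₀ h3]
    calc a * Real.log n < C * Real.log n := mul_lt_mul_of_pos_right hC1 h3
      _ ≤ ((q * k : ℕ) : ℝ) := h4
      _ = mDisjunct δ n d := by rw [mDisjunct, hm]
  · obtain ⟨C, hC1, hC2⟩ := exists_between ha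
    filter_upwards [eventually_mDisjunct_le hδ0 hd hC1, eventually_log_pos] with n h1 h2
    rw [div_lt_iff₀ h2]
    exact h1.2.trans_lt (mul_lt_mul_of_pos_right hC2 h2)

/-- The union bound over `I` and the sets `I \ {j}`. -/
theorem le_utdProb_isSeparable {k n q d : ℕ} (hq : 0 < q) {δ : ℝ} (hδ : 0 ≤ δ)
    (h : ∀ I : Finset (Fin n), I.card ≤ d →
      1 - δ / (d + 1) ≤ utdProb k n q (fun M => IsDisjunct M I))
    (I : Finset (Fin n)) (hI : I.card ≤ d) :
    1 - δ ≤ utdProb k n q (fun M => IsSeparable d M I) := by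
  classical
  have := one_sub_le_utdProb (k := k) hq (insert I (I.image I.erase))
    (E := fun J M => IsDisjunct M J) (F := fun M => IsSeparable d M I) (ε := δ / (d + 1)) ?_ ?_
  · have h1 : ((insert I (I.image I.erase)).card : ℝ) ≤ d + 1 := by
      exact_mod_cast (Finset.card_insert_le _ _).trans
        (Nat.add_le_add_right (Finset.card_image_le.trans hI) 1)
    have h2 := mul_le_mul_of_nonneg_right h1 (show 0 ≤ δ / ((d : ℝ) + 1) by positivity)
    rw [mul_div_cancel₀ δ (by positivity : (d : ℝ) + 1 ≠ 0)] at h2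
    linarith
  · intro M hM
    exact isSeparable_of_isDisjunct d M I (hM I (Finset.mem_insert_self _ _)) fun j hj =>
      hM _ (Finset.mem_insert_of_mem (Finset.mem_image_of_mem _ hj))
  · intro J hJ
    refine h J ?_
    simp only [Finset.mem_insert, Finset.mem_image] at hJ
    rcases hJ with rfl | ⟨j, -, rfl⟩
    · exact hI
    · exact Finset.card_erase_le.trans hI

/-- For large `n` the sets of admissible numbers of tests are nonempty, so that the comparison is
not affected by the value of `sInf` on the empty set. -/
theorem eventually_mSeparable_le {δ : ℝ} (hδ0 : 0 < δ) {d : ℕ} (hd : 1 ≤ d) :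
    ∀ᶠ n : ℕ in atTop, {m : ℕ | ∃ q k : ℕ, 2 ≤ q ∧ q ≤ n ∧ m = q * k ∧
      ∀ I : Finset (Fin n), I.card ≤ d →
        1 - δ ≤ utdProb k n q (fun M => IsSeparable d M I)}.Nonempty ∧
      mSeparable δ n d ≤ mDisjunct (δ / (d + 1)) n d := by
  filter_upwards [eventually_mDisjunct_le (show 0 < δ / ((d : ℝ) + 1) by positivity) hd
    (lt_add_one (threshold d))] with n h
  obtain ⟨q, k, hq, hqn, hm, hI⟩ := Nat.sInf_mem h.1
  have hmem : mDisjunct (δ / (d + 1)) n d ∈ {m : ℕ | ∃ q k : ℕ, 2 ≤ q ∧ q ≤ n ∧ m = q * k ∧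
      ∀ I : Finset (Fin n), I.card ≤ d →
        1 - δ ≤ utdProb k n q (fun M => IsSeparable d M I)} :=
    ⟨q, k, hq, hqn, hm, le_utdProb_isSeparable (by omega) hδ0.le hI⟩
  exact ⟨⟨_, hmem⟩, Nat.sInf_le hmem⟩

theorem eventually_mDisjunct_le_mSeparable {δ : ℝ} (hδ0 : 0 < δ) (d : ℕ) :
    ∀ᶠ n : ℕ in atTop, mDisjunct δ n d ≤ mSeparable δ n (d + 1) := by
  filter_upwards [eventually_mSeparable_le hδ0 (Nat.le_add_left 1 d)] with n h
  obtain ⟨q, k, hq, hqn, hm, hI⟩ := Nat.sInf_mem h.1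
  refine Nat.sInf_le ⟨q, k, hq, hqn, hm, fun I hId => ?_⟩
  exact (hI I (by omega)).trans
    (utdProb_mono (by omega) fun M hM => isDisjunct_of_isSeparable (by omega) hM)

theorem cUpper_le_threshold {δ : ℝ} (hδ0 : 0 < δ) (hδ1 : δ < 1) {d : ℕ} (hd : 1 ≤ d) :
    cUpper δ d ≤ (threshold d : EReal) := by
  have hδ' : δ / ((d : ℝ) + 1) < 1 :=
    (div_le_self hδ0.le (by linarith [(Nat.cast_nonneg d : (0 : ℝ) ≤ d)])).trans_lt hδ1
  have h := (continuous_coe_real_ereal.tendsto _).comp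
    (tendsto_mDisjunct (show 0 < δ / ((d : ℝ) + 1) by positivity) hδ' hd)
  rw [← h.limsup_eq]
  refine limsup_le_limsup ?_
  filter_upwards [eventually_mSeparable_le hδ0 hd, eventually_log_pos] with n h1 h2
  rw [Function.comp_apply, EReal.coe_le_coe_iff]
  exact div_le_div_of_nonneg_right (by exact_mod_cast h1.2) h2.le

theorem threshold_le_cLower_succ {δ : ℝ} (hδ0 : 0 < δ) (hδ1 : δ < 1) {d : ℕ} (hd : 1 ≤ d) :
    (threshold d : EReal) ≤ cLower δ (d + 1) := by
  have h := (continuous_coe_real_ereal.tendsto _).comp (tendsto_mDisjunct hδ0 hδ1 hd)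
  rw [← h.liminf_eq]
  refine liminf_le_liminf ?_
  filter_upwards [eventually_mDisjunct_le_mSeparable hδ0 d, eventually_log_pos] with n h1 h2
  rw [Function.comp_apply, EReal.coe_le_coe_iff]
  exact div_le_div_of_nonneg_right (by exact_mod_cast h1) h2.le

lemma cLower_le_cUpper (δ : ℝ) (d : ℕ) : cLower δ d ≤ cUpper δ d :=
  liminf_le_limsup

/-! ### Growth of the threshold with the number of defectives -/

theorem le_threshold_div {d : ℕ} (hd : 1 ≤ d) :
    1 / (Real.log 2 ^ 2 + 4 / d) ≤ threshold d / d := by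
  have hd0 : (0 : ℝ) < d := by exact_mod_cast hd
  have hl : 0 < Real.log 2 := Real.log_pos one_lt_two
  obtain ⟨q, hq, h⟩ := (isLeast_threshold hd).1
  rw [h, div_div, div_le_div_iff₀ (by positivity) (mul_pos (rate_pos hq hd) hd0)]
  linarith [rate_mul_le hq hd]

theorem threshold_div_le {d : ℕ} (hd : 1 ≤ d) :
    threshold d / d ≤ 1 / Real.log 2 ^ 2 + 2 / Real.log 2 / d := by
  have hd0 : (0 : ℝ) < d := by exact_mod_cast hd
  have hl : 0 < Real.log 2 := Real.log_pos one_lt_two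
  have hpos : 0 < (d : ℝ) / Real.log 2 := by positivity
  have h1 := log_two_le_rate hd
  have h2 : 1 ≤ ⌈(d : ℝ) / Real.log 2⌉₊ := Nat.ceil_pos.2 hpos
  have h3 := (Nat.ceil_lt_add_one hpos.le).le
  have h4 := (isLeast_threshold hd).2 ⟨⌈(d : ℝ) / Real.log 2⌉₊ + 1, by omega, rfl⟩
  rw [div_le_iff₀ hd0]
  refine h4.trans ?_
  calc ((⌈(d : ℝ) / Real.log 2⌉₊ + 1 : ℕ) : ℝ) / rate (⌈(d : ℝ) / Real.log 2⌉₊ + 1) d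
      ≤ ((⌈(d : ℝ) / Real.log 2⌉₊ + 1 : ℕ) : ℝ) / Real.log 2 := by gcongr
    _ ≤ (d / Real.log 2 + 2) / Real.log 2 := by
      gcongr
      push_cast
      linarith
    _ = _ := by field_simp

theorem tendsto_threshold_div :
    Tendsto (fun d : ℕ => threshold d / d) atTop (𝓝 (1 / Real.log 2 ^ 2)) := by
  have hl : 0 < Real.log 2 := Real.log_pos one_lt_two
  have h4 : Tendsto (fun d : ℕ => 1 / (Real.log 2 ^ 2 + 4 / (d : ℝ))) atTop
      (𝓝 (1 / Real.log 2 ^ 2)) := by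
    have := (tendsto_const_div_atTop_nhds_zero_nat 4).const_add (Real.log 2 ^ 2)
    rw [add_zero] at this
    exact tendsto_const_nhds.div this (by positivity)
  have h2 : Tendsto (fun d : ℕ => 1 / Real.log 2 ^ 2 + 2 / Real.log 2 / (d : ℝ)) atTop
      (𝓝 (1 / Real.log 2 ^ 2)) := by
    have := (tendsto_const_div_atTop_nhds_zero_nat (2 / Real.log 2)).const_add
      (1 / Real.log 2 ^ 2)
    rwa [add_zero] at this
  refine tendsto_of_tendsto_of_tendsto_of_le_of_le' h4 h2 ?_ ?_
  · filter_upwards [eventually_ge_atTop 1] with d hd using le_threshold_div hd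
  · filter_upwards [eventually_ge_atTop 1] with d hd using threshold_div_le hd

/-- A quantity between `threshold (d - 1)` and `threshold d` has the same linear growth in `d`. -/
lemma tendsto_div_of_threshold_le {c : ℕ → EReal}
    (h1 : ∀ d, 1 ≤ d → (threshold d : EReal) ≤ c (d + 1))
    (h2 : ∀ d, 1 ≤ d → c d ≤ (threshold d : EReal)) :
    Tendsto (fun d : ℕ => c d / (d : EReal)) atTop (𝓝 ((1 / Real.log 2 ^ 2 : ℝ) : EReal)) := by
  rw [← tendsto_add_atTop_iff_nat 1]
  have hlow : Tendsto (fun d : ℕ => threshold d / ((d + 1 : ℕ) : ℝ)) atTop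
      (𝓝 (1 / Real.log 2 ^ 2)) := by
    have h := tendsto_threshold_div.mul (tendsto_natCast_div_add_atTop (1 : ℝ))
    rw [mul_one] at h
    refine h.congr' ?_
    filter_upwards [eventually_ge_atTop 1] with d hd
    have hd0 : (0 : ℝ) < d := by exact_mod_cast hd
    push_cast
    field_simp
  have hup := (tendsto_add_atTop_iff_nat 1).2 tendsto_threshold_div
  refine tendsto_of_tendsto_of_tendsto_of_le_of_le'
    ((continuous_coe_real_ereal.tendsto _).comp hlow)
    ((continuous_coe_real_ereal.tendsto _).comp hup) ?_ ?_
  · filter_upwards [eventually_ge_atTop 1] with d hd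
    rw [Function.comp_apply, EReal.coe_div, EReal.coe_natCast]
    exact EReal.div_le_div_right_of_nonneg (Nat.cast_nonneg' _) (h1 d hd)
  · filter_upwards [eventually_ge_atTop 1] with d hd
    rw [Function.comp_apply, EReal.coe_div, EReal.coe_natCast]
    exact EReal.div_le_div_right_of_nonneg (Nat.cast_nonneg' _) (h2 (d + 1) (by omega))

end GroupTesting

theorem theorem4 (δ : ℝ) (hδ0 : 0 < δ) (hδ1 : δ < 1) :
    (∃ cD : ℕ → ℝ,
      (∀ d : ℕ, 1 ≤ d →
        IsLeast {x : ℝ | ∃ q : ℕ, 2 ≤ q ∧ x = (q : ℝ) / (-Real.log (GroupTesting.P q d))} (cD d) ∧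
        Tendsto (fun n : ℕ => (GroupTesting.mDisjunct δ n d : ℝ) / Real.log n) atTop
          (𝓝 (cD d))) ∧
      Tendsto (fun d : ℕ => cD d / (d : ℝ)) atTop (𝓝 (1 / (Real.log 2) ^ 2))) ∧
    Tendsto (fun d : ℕ => GroupTesting.cLower δ d / (d : EReal)) atTop
      (𝓝 ((1 / (Real.log 2) ^ 2 : ℝ) : EReal)) ∧
    Tendsto (fun d : ℕ => GroupTesting.cUpper δ d / (d : EReal)) atTop
      (𝓝 ((1 / (Real.log 2) ^ 2 : ℝ) : EReal)) := by
  refine ⟨⟨GroupTesting.threshold, fun d hd => ⟨?_, GroupTesting.tendsto_mDisjunct hδ0 hδ1 hd⟩,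
    GroupTesting.tendsto_threshold_div⟩, ?_, ?_⟩
  · convert GroupTesting.isLeast_threshold hd using 1
    ext x
    refine exists_congr fun q => and_congr_right fun hq => ?_
    rw [GroupTesting.rate_eq_neg_log_P hq hd]
  · exact GroupTesting.tendsto_div_of_threshold_le
      (fun d hd => GroupTesting.threshold_le_cLower_succ hδ0 hδ1 hd)
      fun d hd => (GroupTesting.cLower_le_cUpper δ d).trans
        (GroupTesting.cUpper_le_threshold hδ0 hδ1 hd)
  · exact GroupTesting.tendsto_div_of_threshold_le
      (fun d hd => (GroupTesting.threshold_le_cLower_succ hδ0 hδ1 hd).trans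
        (GroupTesting.cLower_le_cUpper δ (d + 1)))
      fun d hd => GroupTesting.cUpper_le_threshold hδ0 hδ1 hd
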